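/- Let $G=(V,E)$ be a finite simple graph and let $\pi:V\to[0,1]$ be a ranking of its vertices. The \emph{lexicographically first maximal independent set} $\mathrm{LFMIS}(G,\pi)$ is built greedily: initially every vertex is alive; as long as some vertex is alive, the alive vertex of minimum rank joins the set and is killed together with all its alive neighbors. The \emph{eliminator} $\mathrm{elim}_{G,\pi}(u)$ of a vertex $u$ is the lowest-rank vertex in $(N_G(u)\cup\{u\})\cap\mathrm{LFMIS}(G,\pi)$. A \emph{random ranking} has ranks $\pi(u)$, $u\in V$, that are independent and uniformly distributed on $[0,1]$ (so that ties have probability zero). For a vertex $v\in V$ let $G'=G[V\setminus\{v\}]$, with the ranking $\pi$ restricted to $V\setminus\{v\}$, and let $$\mathcal A_\pi(G,G')=\{v\}\cup\{u\in V\setminus\{v\} : \mathrm{elim}_{G,\pi}(u)\neq \mathrm{elim}_{G',\pi}(u)\}$$ be the set of vertices whose eliminators in the two graphs differ (the deleted vertex $v$, which has no eliminator in $G'$, is counted). \textbf{Theorem.} There is an absolute constant $C>0$ such that for every finite simple graph $G=(V,E)$ with $n=|V|\ge 2$ vertices and every $v\in V$, if $\pi$ is a random ranking of $V$ and $G'=G[V\setminus\{v\}]$,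 then $$\mathbb E_\pi\big[\,|\mathcal A_\pi(G,G')|\,\big]\le C\log n .$$ -/

import Mathlib

open MeasureTheory

namespace RandomLFMIS

/-- A vertex of minimum rank in a nonempty set `s` of vertices. It is unique whenever the
ranking `π` is injective; ties are broken by an arbitrary choice. -/
noncomputable def minRank {W R : Type*} [Finite W] [LinearOrder R]
    (π : W → R) (s : Set W) (hs : s.Nonempty) : W :=
  (Set.exists_min_image s π s.toFinite hs).choose

theorem minRank_mem {W R : Type*} [Finite W] [LinearOrder R]
    (π : W → R) (s : Set W) (hs : s.Nonempty) : minRank π s hs ∈ s :=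
  (Set.exists_min_image s π s.toFinite hs).choose_spec.1

theorem minRank_le {W R : Type*} [Finite W] [LinearOrder R]
    (π : W → R) (s : Set W) (hs : s.Nonempty) {u : W} (hu : u ∈ s) :
    π (minRank π s hs) ≤ π u :=
  (Set.exists_min_image s π s.toFinite hs).choose_spec.2 u hu

/-- The closed neighborhood `Γ(v) = N(v) ∪ {v}`. -/
def closedNbhd {W : Type*} (G : SimpleGraph W) (v : W) : Set W :=
  insert v (G.neighborSet v)

theorem ncard_alive_lt {W R : Type*} [Finite W] [LinearOrder R]
    (G : SimpleGraph W) (π : W → R) (alive : Set W) (h : alive.Nonempty) :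
    (alive \ closedNbhd G (minRank π alive h)).ncard < alive.ncard := by
  refine Set.ncard_lt_ncard ⟨Set.sdiff_subset, fun hsub => ?_⟩ alive.toFinite
  exact (hsub (minRank_mem π alive h)).2 (Set.mem_insert _ _)

open Classical in
/-- The greedy process, started from the set `alive` of alive vertices: as long as some vertex is
alive, take the alive vertex of minimum rank, let it join the independent set, and kill it together
with all its alive neighbors. The result is the set of vertices that join. -/
noncomputable def greedyMIS {W R : Type*} [Finite W] [LinearOrder R]
    (G : SimpleGraph W) (π : W → R) (alive : Set W) : Set W :=
  if h : alive.Nonempty then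
    insert (minRank π alive h) (greedyMIS G π (alive \ closedNbhd G (minRank π alive h)))
  else ∅
termination_by alive.ncard
decreasing_by exact ncard_alive_lt G π alive h

/-- The lexicographically first maximal independent set of `G` according to the ranking `π`. -/
noncomputable def LFMIS {W R : Type*} [Finite W] [LinearOrder R]
    (G : SimpleGraph W) (π : W → R) : Set W :=
  greedyMIS G π Set.univ

theorem closedNbhd_inter_greedyMIS_nonempty {W R : Type*} [Finite W] [LinearOrder R]
    (G : SimpleGraph W) (π : W → R) (alive : Set W) :
    ∀ u ∈ alive, (closedNbhd G u ∩ greedyMIS G π alive).Nonempty := by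
  induction hk : alive.ncard using Nat.strong_induction_on generalizing alive with
  | _ k ih =>
    intro u hu
    have h : alive.Nonempty := ⟨u, hu⟩
    rw [greedyMIS, dif_pos h]
    by_cases hmem : u ∈ closedNbhd G (minRank π alive h)
    · refine ⟨minRank π alive h, ?_, Set.mem_insert _ _⟩
      rcases hmem with rfl | hadj
      · exact Set.mem_insert _ _
      · exact Set.mem_insert_of_mem _ (G.adj_symm hadj)
    · obtain ⟨w, hw, hw'⟩ := ih _ (hk ▸ ncard_alive_lt G π alive h)
        (alive \ closedNbhd G (minRank π alive h)) rfl u ⟨hu, hmem⟩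
      exact ⟨w, hw, Set.mem_insert_of_mem _ hw'⟩

/-- Every closed neighborhood meets the LFMIS, so that eliminators exist. -/
theorem closedNbhd_inter_LFMIS_nonempty {W R : Type*} [Finite W] [LinearOrder R]
    (G : SimpleGraph W) (π : W → R) (u : W) : (closedNbhd G u ∩ LFMIS G π).Nonempty :=
  closedNbhd_inter_greedyMIS_nonempty G π Set.univ u (Set.mem_univ u)

/-- The eliminator of `u`: the lowest-rank vertex in `(N(u) ∪ {u}) ∩ LFMIS(G, π)`. -/
noncomputable def eliminator {W R : Type*} [Finite W] [LinearOrder R]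
    (G : SimpleGraph W) (π : W → R) (u : W) : W :=
  minRank π (closedNbhd G u ∩ LFMIS G π) (closedNbhd_inter_LFMIS_nonempty G π u)

/-- The affected vertices for a graph `G` on `V` and a graph `G'` on a subset `V'` of `V`, under a
ranking `π` of `V` (restricted to `V'` for `G'`): the vertices of `V` whose eliminators in the two
graphs differ. A vertex outside `V'` has no eliminator in `G'` and counts as affected. -/
def affected {V R : Type*} [Finite V] [LinearOrder R]
    (G : SimpleGraph V) (V' : Set V) (G' : SimpleGraph V') (π : V → R) : Set V :=
  {u | ¬ ∃ h : u ∈ V', ((eliminator G' (fun w : V' => π w) ⟨u, h⟩ : V') : V) = eliminator G π u}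

/-- The law of a random ranking: the ranks `π u`, for `u` in `V`, are independent and uniformly
distributed on `[0, 1]`. -/
noncomputable def randomRanking (V : Type*) [Fintype V] : Measure (V → unitInterval) :=
  Measure.pi fun _ => volume

end RandomLFMIS

namespace RandomLFMIS

/-! ### The greedy process and the lexicographically first maximal independent set -/

theorem greedyMIS_subset {W R : Type*} [Finite W] [LinearOrder R]
    (G : SimpleGraph W) (π : W → R) (alive : Set W) : greedyMIS G π alive ⊆ alive := by
  induction hk : alive.ncard using Nat.strong_induction_on generalizing alive with
  | _ k ih =>
    rw [greedyMIS]
    split_ifs with h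
    · refine Set.insert_subset (minRank_mem π alive h) ?_
      exact (ih _ (hk ▸ ncard_alive_lt G π alive h) _ rfl).trans Set.sdiff_subset
    · exact Set.empty_subset _

theorem mem_greedyMIS_iff {W R : Type*} [Finite W] [LinearOrder R]
    (G : SimpleGraph W) {π : W → R} (hπ : Function.Injective π) (alive : Set W) (u : W) :
    u ∈ greedyMIS G π alive ↔
      u ∈ alive ∧ ∀ x ∈ greedyMIS G π alive, G.Adj u x → ¬ π x < π u := by
  induction hk : alive.ncard using Nat.strong_induction_on generalizing alive with
  | _ k ih =>
    by_cases h : alive.Nonempty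
    swap
    · rw [Set.not_nonempty_iff_eq_empty] at h
      subst h
      have h0 : greedyMIS G π ∅ = ∅ := Set.subset_empty_iff.1 (greedyMIS_subset G π ∅)
      simp [h0]
    have ih' := ih _ (hk ▸ ncard_alive_lt G π alive h)
      (alive \ closedNbhd G (minRank π alive h)) rfl
    have hsub := greedyMIS_subset G π (alive \ closedNbhd G (minRank π alive h))
    have hm := minRank_mem π alive h
    have hle : ∀ x ∈ alive, π (minRank π alive h) ≤ π x := fun x hx => minRank_le π alive h hx
    rw [greedyMIS, dif_pos h]
    generalize minRank π alive h = m at *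
    constructor
    · rintro (rfl | hu)
      · refine ⟨hm, ?_⟩
        rintro x (rfl | hx) - hlt
        · exact lt_irrefl _ hlt
        · exact not_lt_of_ge (hle x (hsub hx).1) hlt
      · refine ⟨(hsub hu).1, ?_⟩
        rintro x (rfl | hx) hadj
        · exact absurd (Or.inr hadj.symm) (hsub hu).2
        · exact (ih'.1 hu).2 x hx hadj
    · rintro ⟨hu, hx⟩
      by_cases hum : u = m
      · exact Or.inl hum
      right
      refine ih'.2 ⟨⟨hu, ?_⟩, fun x hxg => hx x (Or.inr hxg)⟩
      rintro (h1 | h1)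
      · exact hum h1
      · exact hx m (Or.inl rfl) h1.symm (lt_of_le_of_ne (hle u hu) (fun h2 => hum (hπ h2).symm))

theorem mem_LFMIS_iff {W R : Type*} [Finite W] [LinearOrder R]
    (G : SimpleGraph W) {π : W → R} (hπ : Function.Injective π) (u : W) :
    u ∈ LFMIS G π ↔ ∀ x ∈ LFMIS G π, G.Adj u x → ¬ π x < π u :=
  (mem_greedyMIS_iff G hπ Set.univ u).trans (by simp [LFMIS])

section Alive

variable {V : Type*}

open Classical in
/-- One step of the greedy process: the arriving vertex `u`, if alive, kills its closed
neighborhood. -/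
noncomputable def aliveStep (G : SimpleGraph V) (S : Finset V) (u : V) : Finset V :=
  if u ∈ S then S.filter fun w => w ≠ u ∧ ¬ G.Adj u w else S

/-- The set of vertices that are alive after the first `k` vertices of the sequence `x` have
arrived, if the vertices of `S` are alive initially. -/
noncomputable def aliveSeq (G : SimpleGraph V) (S : Finset V) (x : ℕ → V) : ℕ → Finset V
  | 0 => S
  | k + 1 => aliveStep G (aliveSeq G S x k) (x k)

theorem mem_aliveStep {G : SimpleGraph V} {S : Finset V} {u w : V} :
    w ∈ aliveStep G S u ↔ w ∈ S ∧ (u ∈ S → w ≠ u ∧ ¬ G.Adj u w) := by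
  unfold aliveStep
  split_ifs with h <;> simp [h]

theorem aliveSeq_congr (G : SimpleGraph V) (S : Finset V) {x y : ℕ → V} {k : ℕ}
    (h : ∀ j < k, x j = y j) : aliveSeq G S x k = aliveSeq G S y k := by
  induction k with
  | zero => rfl
  | succ k ih =>
    simp only [aliveSeq]
    rw [ih fun j hj => h j (by omega), h k (by omega)]

theorem mem_aliveSeq {G : SimpleGraph V} {S : Finset V} {x : ℕ → V} {k : ℕ} {w : V} :
    w ∈ aliveSeq G S x k ↔
      w ∈ S ∧ ∀ j < k, x j ∈ aliveSeq G S x j → w ≠ x j ∧ ¬ G.Adj (x j) w := by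
  induction k with
  | zero => simp [aliveSeq]
  | succ k ih =>
    rw [aliveSeq, mem_aliveStep, ih, and_assoc]
    refine and_congr_right fun _ => ⟨?_, fun h => ⟨fun j hj => h j (by omega), h k (by omega)⟩⟩
    rintro ⟨h1, h2⟩ j hj
    rcases Nat.lt_succ_iff_lt_or_eq.1 hj with h | rfl
    · exact h1 j h
    · exact h2

theorem aliveSeq_subset {G : SimpleGraph V} {S : Finset V} {x : ℕ → V} {j k : ℕ} (h : j ≤ k) :
    aliveSeq G S x k ⊆ aliveSeq G S x j := fun w hw => by
  rw [mem_aliveSeq] at hw ⊢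
  exact ⟨hw.1, fun i hi => hw.2 i (hi.trans_le h)⟩

theorem not_mem_aliveSeq_of_lt {G : SimpleGraph V} {S : Finset V} {x : ℕ → V} {j k : ℕ}
    (h : j < k) : x j ∉ aliveSeq G S x k := fun hj =>
  ((mem_aliveSeq.1 hj).2 j h (aliveSeq_subset h.le hj)).1 rfl

/-- Every vertex dies at some step, once every vertex has arrived. -/
theorem exists_dies {G : SimpleGraph V} {S : Finset V} {x : ℕ → V} {n : ℕ}
    (hsurj : ∀ w, ∃ k < n, x k = w) {u : V} (hu : u ∈ S) :
    ∃ k < n, u ∈ aliveSeq G S x k ∧ u ∉ aliveSeq G S x (k + 1) := by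
  by_contra! hcon
  have key : ∀ k ≤ n, u ∈ aliveSeq G S x k := by
    intro k
    induction k with
    | zero => exact fun _ => hu
    | succ k ih => exact fun hk => hcon k (by omega) (ih (by omega))
  obtain ⟨k, hk, rfl⟩ := hsurj u
  exact not_mem_aliveSeq_of_lt hk (key n le_rfl)

/-- The ranking `π` sorts the vertices as `x 0, x 1, …, x (n - 1)`. -/
structure Sorts {R : Type*} [LinearOrder R] (π : V → R) (x : ℕ → V) (n : ℕ) : Prop where
  lt : ∀ i j, i < j → j < n → π (x i) < π (x j)
  surj : ∀ w, ∃ k < n, x k = w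

namespace Sorts

variable {R : Type*} [LinearOrder R] {π : V → R} {x : ℕ → V} {n : ℕ}

theorem lt_of_lt (h : Sorts π x n) {i j : ℕ} (hi : i < n) (hij : π (x i) < π (x j)) : i < j := by
  by_contra! hji
  rcases hji.lt_or_eq with h1 | rfl
  · exact lt_asymm hij (h.lt j i h1 hi)
  · exact lt_irrefl _ hij

theorem inj (h : Sorts π x n) {i j : ℕ} (hi : i < n) (hj : j < n) (hij : x i = x j) : i = j := by
  rcases lt_trichotomy i j with h1 | h1 | h1
  · exact absurd (h.lt i j h1 hj) (by simp [hij])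
  · exact h1
  · exact absurd (h.lt j i h1 hi) (by simp [hij])

theorem injective (h : Sorts π x n) : Function.Injective π := by
  intro a b hab
  obtain ⟨i, hi, rfl⟩ := h.surj a
  obtain ⟨j, hj, rfl⟩ := h.surj b
  rcases lt_trichotomy i j with h1 | h1 | h1
  · exact absurd (h.lt i j h1 hj) (by simp [hab])
  · rw [h1]
  · exact absurd (h.lt j i h1 hi) (by simp [hab])

variable {W : Type*} [Finite W] {G : SimpleGraph V} {S : Finset V} (ι : W ↪ V)

/-- The vertices that join the LFMIS of an induced subgraph are those that arrive alive. -/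
theorem mem_LFMIS_comap_iff (h : Sorts π x n) (hS : ∀ w, w ∈ S ↔ w ∈ Set.range ι) (k : ℕ)
    (hk : k < n) (w : W) (hw : ι w = x k) :
    w ∈ LFMIS (G.comap ι) (fun a => π (ι a)) ↔ x k ∈ aliveSeq G S x k := by
  induction k using Nat.strong_induction_on generalizing w with
  | _ k ih =>
    rw [mem_LFMIS_iff (G.comap ι) (π := fun a => π (ι a)) (h.injective.comp ι.injective),
      mem_aliveSeq]
    constructor
    · intro hx
      refine ⟨(hS _).2 ⟨w, hw⟩, fun j hj hja => ⟨fun hne => ?_, fun hadj => ?_⟩⟩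
      · exact hj.ne' (h.inj hk (hj.trans hk) hne)
      · obtain ⟨y, hy⟩ := (hS _).1 (mem_aliveSeq.1 hja).1
        refine hx y ((ih j hj (hj.trans hk) y hy).2 hja) ?_ ?_
        · rw [SimpleGraph.comap_adj, hw, hy]
          exact hadj.symm
        · rw [hw, hy]
          exact h.lt j k hj hk
    · rintro ⟨-, hx⟩ y hy hadj hlt
      obtain ⟨j, hj, hjy⟩ := h.surj (ι y)
      rw [hw, ← hjy] at hlt
      have hjk := h.lt_of_lt hj hlt
      refine (hx j hjk ((ih j hjk hj y hjy.symm).1 hy)).2 ?_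
      rw [SimpleGraph.comap_adj, hw, ← hjy] at hadj
      exact hadj.symm

/-- The eliminator of a vertex is the vertex whose arrival kills it. -/
theorem eliminator_comap (h : Sorts π x n) (hS : ∀ w, w ∈ S ↔ w ∈ Set.range ι) {k : ℕ}
    (hk : k < n) {u : W} (hu : ι u ∈ aliveSeq G S x k) (hu' : ι u ∉ aliveSeq G S x (k + 1)) :
    ι (eliminator (G.comap ι) (fun a => π (ι a)) u) = x k := by
  rw [aliveSeq, mem_aliveStep] at hu'
  have hxk : x k ∈ aliveSeq G S x k := by
    by_contra hcon
    exact hu' ⟨hu, fun hc => absurd hc hcon⟩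
  obtain ⟨w, hw⟩ := (hS _).1 (mem_aliveSeq.1 hxk).1
  have hwmem : w ∈ closedNbhd (G.comap ι) u ∩ LFMIS (G.comap ι) (fun a => π (ι a)) := by
    refine ⟨?_, (h.mem_LFMIS_comap_iff ι hS k hk w hw).2 hxk⟩
    by_cases huw : ι u = x k
    · exact Or.inl (ι.injective (hw.trans huw.symm))
    · right
      rw [SimpleGraph.mem_neighborSet, SimpleGraph.comap_adj, hw]
      by_contra hcon
      exact hu' ⟨hu, fun _ => ⟨huw, fun hadj => hcon hadj.symm⟩⟩
  have hmin := minRank_mem (fun a => π (ι a)) _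
    (closedNbhd_inter_LFMIS_nonempty (G.comap ι) (fun a => π (ι a)) u)
  have hle := minRank_le (fun a => π (ι a)) _
    (closedNbhd_inter_LFMIS_nonempty (G.comap ι) (fun a => π (ι a)) u) hwmem
  change eliminator (G.comap ι) (fun a => π (ι a)) u ∈ _ at hmin
  change π (ι (eliminator (G.comap ι) (fun a => π (ι a)) u)) ≤ π (ι w) at hle
  generalize eliminator (G.comap ι) (fun a => π (ι a)) u = m at *
  obtain ⟨j, hj, hjm⟩ := h.surj (ι m)
  rw [hw, ← hjm] at hle
  rcases lt_trichotomy j k with h1 | h1 | h1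
  · exfalso
    have hja := (h.mem_LFMIS_comap_iff ι hS j hj m hjm.symm).1 hmin.2
    have := (mem_aliveSeq.1 hu).2 j h1 hja
    rcases hmin.1 with h2 | h2
    · exact this.1 (by rw [hjm, h2])
    · rw [SimpleGraph.mem_neighborSet, SimpleGraph.comap_adj, ← hjm] at h2
      exact this.2 h2.symm
  · rw [← hjm, h1]
  · exact absurd (h.lt k j h1 hj) (not_lt_of_ge hle)

end Sorts

end Alive

/-! ### Counting discordant vertices under a uniformly random arrival -/

section Counting

variable {V : Type*}

open Classical in
/-- The vertices that are alive in exactly one of the two graphs. -/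
noncomputable def discord (P Q : Finset V) : Finset V := symmDiff P Q

open Classical in
/-- The vertices that are alive in both graphs and become discordant when `u` arrives. -/
noncomputable def newDiscord (G : SimpleGraph V) (P Q : Finset V) (u : V) : Finset V :=
  (P ∩ Q) ∩ discord (aliveStep G P u) (aliveStep G Q u)

open Classical in
/-- The edges between a discordant vertex and a vertex that is alive in both graphs. -/
noncomputable def crossEdges (G : SimpleGraph V) (P Q : Finset V) : Finset (V × V) :=
  (discord P Q ×ˢ (P ∩ Q)).filter fun p => G.Adj p.1 p.2

open Classical in
/-- The pairs of vertices alive in both graphs, together with a common discordant neighbor. -/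
noncomputable def crossCherries (G : SimpleGraph V) (P Q : Finset V) : Finset (V × V × V) :=
  (discord P Q ×ˢ (P ∩ Q) ×ˢ (P ∩ Q)).filter fun p => G.Adj p.1 p.2.1 ∧ G.Adj p.1 p.2.2

open Classical in
/-- The induced paths that lead from a discordant vertex to two vertices alive in both graphs. -/
noncomputable def crossPaths (G : SimpleGraph V) (P Q : Finset V) : Finset (V × V × V) :=
  (discord P Q ×ˢ (P ∩ Q) ×ˢ (P ∩ Q)).filter fun p =>
    G.Adj p.1 p.2.1 ∧ G.Adj p.2.1 p.2.2 ∧ ¬ G.Adj p.1 p.2.2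

theorem mem_discord {P Q : Finset V} {u : V} :
    u ∈ discord P Q ↔ u ∈ P ∧ u ∉ Q ∨ u ∈ Q ∧ u ∉ P := by
  simp [discord, Finset.mem_symmDiff]

theorem mem_newDiscord {G : SimpleGraph V} {P Q : Finset V} {u w : V} :
    w ∈ newDiscord G P Q u ↔
      (w ∈ P ∧ w ∈ Q) ∧ w ∈ discord (aliveStep G P u) (aliveStep G Q u) := by
  simp [newDiscord, and_assoc]

theorem mem_crossEdges {G : SimpleGraph V} {P Q : Finset V} {p : V × V} :
    p ∈ crossEdges G P Q ↔ (p.1 ∈ discord P Q ∧ p.2 ∈ P ∧ p.2 ∈ Q) ∧ G.Adj p.1 p.2 := by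
  simp [crossEdges]

theorem mem_crossCherries {G : SimpleGraph V} {P Q : Finset V} {p : V × V × V} :
    p ∈ crossCherries G P Q ↔
      (p.1 ∈ discord P Q ∧ (p.2.1 ∈ P ∧ p.2.1 ∈ Q) ∧ p.2.2 ∈ P ∧ p.2.2 ∈ Q) ∧
        G.Adj p.1 p.2.1 ∧ G.Adj p.1 p.2.2 := by
  simp [crossCherries]

theorem mem_crossPaths {G : SimpleGraph V} {P Q : Finset V} {p : V × V × V} :
    p ∈ crossPaths G P Q ↔
      (p.1 ∈ discord P Q ∧ (p.2.1 ∈ P ∧ p.2.1 ∈ Q) ∧ p.2.2 ∈ P ∧ p.2.2 ∈ Q) ∧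
        G.Adj p.1 p.2.1 ∧ G.Adj p.2.1 p.2.2 ∧ ¬ G.Adj p.1 p.2.2 := by
  simp [crossPaths]

open Classical in
theorem sum_card_fiber_eq {α : Type*} (T : Finset α) (f : α → V) (U : Finset V)
    (h : ∀ p ∈ T, f p ∈ U) : ∑ u ∈ U, (T.filter fun p => f p = u).card = T.card :=
  (Finset.card_eq_sum_card_fiberwise h).symm

theorem discord_adj_of_mem_newDiscord {G : SimpleGraph V} {P Q : Finset V} {u w : V}
    (hw : w ∈ newDiscord G P Q u) : u ∈ discord P Q ∧ G.Adj u w := by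
  rw [mem_newDiscord] at hw
  simp only [mem_discord, mem_aliveStep] at hw
  rw [mem_discord]
  by_cases huw : w = u
  · subst huw; tauto
  · tauto

theorem mem_discord_step {G : SimpleGraph V} {P Q : Finset V} {u w : V}
    (hw : w ∈ discord (aliveStep G P u) (aliveStep G Q u)) :
    w ∈ discord P Q ∨ w ∈ newDiscord G P Q u := by
  rw [mem_newDiscord, mem_discord]
  have hw2 := hw
  simp only [mem_discord, mem_aliveStep] at hw2
  tauto

open Classical in
theorem card_newDiscord_le (G : SimpleGraph V) (P Q : Finset V) (u : V) :
    (newDiscord G P Q u).card ≤ ((crossEdges G P Q).filter fun p => p.1 = u).card := by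
  refine Finset.card_le_card_of_injOn (fun w => (u, w)) (fun w hw => ?_)
    (fun a _ b _ hab => (Prod.ext_iff.1 hab).2)
  have h := discord_adj_of_mem_newDiscord hw
  exact Finset.mem_filter.2
    ⟨mem_crossEdges.2 ⟨⟨h.1, (mem_newDiscord.1 hw).1⟩, h.2⟩, rfl⟩

theorem sum_card_newDiscord_le (G : SimpleGraph V) {P Q U : Finset V} (hP : P ⊆ U) (hQ : Q ⊆ U) :
    ∑ u ∈ U, (newDiscord G P Q u).card ≤ (crossEdges G P Q).card := by
  classical
  rw [← sum_card_fiber_eq (crossEdges G P Q) Prod.fst U]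
  · exact Finset.sum_le_sum fun u _ => card_newDiscord_le G P Q u
  · intro p hp
    have := (mem_crossEdges.1 hp).1.1
    rw [mem_discord] at this
    exact this.elim (fun h => hP h.1) fun h => hQ h.1

open Classical in
theorem card_discord_step_le (G : SimpleGraph V) (P Q : Finset V) (u : V) :
    (discord (aliveStep G P u) (aliveStep G Q u)).card +
        ((if u ∈ discord P Q then 1 else 0) +
          ((crossEdges G P Q).filter fun p => p.2 = u).card) ≤
      (discord P Q).card + (newDiscord G P Q u).card := by
  set Z := discord P Q
  set Z' := discord (aliveStep G P u) (aliveStep G Q u) with hZ'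
  have h1 : Z' ⊆ (Z ∩ Z') ∪ newDiscord G P Q u := by
    intro w hw
    rw [Finset.mem_union, Finset.mem_inter]
    exact (mem_discord_step hw).imp_left fun h => ⟨h, hw⟩
  have h2 : (if u ∈ Z then 1 else 0) + ((crossEdges G P Q).filter fun p => p.2 = u).card ≤
      (Z \ Z').card := by
    by_cases hu : u ∈ Z
    · have h0 : ((crossEdges G P Q).filter fun p => p.2 = u) = ∅ := by
        refine Finset.filter_eq_empty_iff.2 fun p hp hpu => ?_
        have := (mem_crossEdges.1 hp).1.2
        rw [hpu] at this
        rw [mem_discord] at hu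
        tauto
      rw [if_pos hu, h0, Finset.card_empty, add_zero, Nat.succ_le_iff, Finset.card_pos]
      refine ⟨u, Finset.mem_sdiff.2 ⟨hu, ?_⟩⟩
      simp only [hZ', mem_discord, mem_aliveStep]
      tauto
    · rw [if_neg hu, zero_add]
      refine Finset.card_le_card_of_injOn Prod.fst (fun p hp => ?_) ?_
      · obtain ⟨hpE, rfl⟩ := Finset.mem_filter.1 (Finset.mem_coe.1 hp)
        obtain ⟨⟨hpZ, hp1, hp2⟩, hadj⟩ := mem_crossEdges.1 hpE
        refine Finset.mem_coe.2 (Finset.mem_sdiff.2 ⟨hpZ, ?_⟩)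
        simp only [hZ', mem_discord, mem_aliveStep]
        have := hadj.symm
        tauto
      · intro a ha b hb hab
        exact Prod.ext hab (((Finset.mem_filter.1 ha).2).trans (Finset.mem_filter.1 hb).2.symm)
  have h3 := (Finset.card_le_card h1).trans (Finset.card_union_le _ _)
  have h4 := Finset.card_sdiff_add_card_inter Z Z'
  omega

theorem sum_card_discord_step_le (G : SimpleGraph V) {P Q U : Finset V} (hP : P ⊆ U)
    (hQ : Q ⊆ U) :
    ∑ u ∈ U, (discord (aliveStep G P u) (aliveStep G Q u)).card + (discord P Q).card ≤
      U.card * (discord P Q).card := by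
  classical
  have h := Finset.sum_le_sum fun u (_ : u ∈ U) => card_discord_step_le G P Q u
  rw [Finset.sum_add_distrib, Finset.sum_add_distrib, Finset.sum_add_distrib,
    sum_card_fiber_eq (crossEdges G P Q) Prod.snd U
      (fun p hp => hP (mem_crossEdges.1 hp).1.2.1), Finset.sum_const, smul_eq_mul,
    ← Finset.card_filter] at h
  have h1 : (U.filter fun u => u ∈ discord P Q) = discord P Q := by
    ext w
    rw [Finset.mem_filter, mem_discord]
    have := @hP w
    have := @hQ w
    tauto
  rw [h1] at h
  have := sum_card_newDiscord_le G hP hQ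
  omega

open Classical in
theorem card_crossEdges_step_le (G : SimpleGraph V) (P Q : Finset V) (u : V) :
    (crossEdges G (aliveStep G P u) (aliveStep G Q u)).card +
        (((crossCherries G P Q).filter fun p => p.2.2 = u).card +
          ((crossPaths G P Q).filter fun p => p.2.2 = u).card) ≤
      (crossEdges G P Q).card + ((crossPaths G P Q).filter fun p => p.1 = u).card := by
  set E := crossEdges G P Q
  set E' := crossEdges G (aliveStep G P u) (aliveStep G Q u) with hE'
  have h1 : (E' \ E).card ≤ ((crossPaths G P Q).filter fun p => p.1 = u).card := by
    refine Finset.card_le_card_of_injOn (fun p => (u, p)) (fun p hp => ?_)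
      (fun a _ b _ hab => (Prod.ext_iff.1 hab).2)
    obtain ⟨hp1, hp2⟩ := Finset.mem_sdiff.1 hp
    obtain ⟨⟨hz, hb, hb'⟩, hadj⟩ := mem_crossEdges.1 hp1
    rw [mem_aliveStep] at hb hb'
    have hnew := (mem_discord_step hz).resolve_left
      fun h => hp2 (mem_crossEdges.2 ⟨⟨h, hb.1, hb'.1⟩, hadj⟩)
    obtain ⟨hu, hadj'⟩ := discord_adj_of_mem_newDiscord hnew
    refine Finset.mem_coe.2 (Finset.mem_filter.2 ⟨mem_crossPaths.2
      ⟨⟨hu, (mem_newDiscord.1 hnew).1, hb.1, hb'.1⟩, hadj', hadj, ?_⟩, rfl⟩)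
    exact (mem_discord.1 hu).elim (fun h => (hb.2 h.1).2) fun h => (hb'.2 h.1).2
  have h2 : ((crossCherries G P Q).filter fun p => p.2.2 = u).card +
      ((crossPaths G P Q).filter fun p => p.2.2 = u).card ≤ (E \ E').card := by
    rw [← Finset.card_union_of_disjoint]
    · refine Finset.card_le_card_of_injOn (fun p => (p.1, p.2.1)) (fun p hp => ?_) ?_
      · refine Finset.mem_coe.2 (Finset.mem_sdiff.2 ?_)
        rw [Finset.mem_coe, Finset.mem_union, Finset.mem_filter, Finset.mem_filter,
          mem_crossCherries, mem_crossPaths, ← or_and_right] at hp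
        obtain ⟨hp, rfl⟩ := hp
        have hc := G.adj_comm p.1 p.2.2
        have hc' := G.adj_comm p.2.1 p.2.2
        simp only [E, hE', mem_crossEdges, mem_discord, mem_aliveStep] at hp ⊢
        tauto
      · intro a ha b hb hab
        simp only [Finset.coe_union, Set.mem_union, Finset.mem_coe, Finset.mem_filter] at ha hb
        have ha' : a.2.2 = u := by tauto
        have hb' : b.2.2 = u := by tauto
        obtain ⟨h1, h2⟩ := Prod.ext_iff.1 hab
        exact Prod.ext h1 (Prod.ext h2 (ha'.trans hb'.symm))
    · refine Finset.disjoint_left.2 fun p hp hp' => ?_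
      rw [Finset.mem_filter, mem_crossCherries] at hp
      rw [Finset.mem_filter, mem_crossPaths] at hp'
      tauto
  have h3 := Finset.card_sdiff_add_card_inter E E'
  have h4 := Finset.card_sdiff_add_card_inter E' E
  rw [Finset.inter_comm] at h4
  omega

theorem sum_card_crossEdges_step_le (G : SimpleGraph V) {P Q U : Finset V} (hP : P ⊆ U)
    (hQ : Q ⊆ U) :
    ∑ u ∈ U, (crossEdges G (aliveStep G P u) (aliveStep G Q u)).card +
        (crossCherries G P Q).card ≤ U.card * (crossEdges G P Q).card := by
  classical
  have h := Finset.sum_le_sum fun u (_ : u ∈ U) => card_crossEdges_step_le G P Q u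
  rw [Finset.sum_add_distrib, Finset.sum_add_distrib, Finset.sum_add_distrib,
    sum_card_fiber_eq (crossCherries G P Q) (fun p => p.2.2) U
      (fun p hp => hP (mem_crossCherries.1 hp).1.2.2.1),
    sum_card_fiber_eq (crossPaths G P Q) (fun p => p.2.2) U
      (fun p hp => hP (mem_crossPaths.1 hp).1.2.2.1),
    sum_card_fiber_eq (crossPaths G P Q) (fun p => p.1) U, Finset.sum_const, smul_eq_mul] at h
  · omega
  · intro p hp
    have := (mem_crossPaths.1 hp).1.1
    rw [mem_discord] at this
    exact this.elim (fun h => hP h.1) fun h => hQ h.1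

/-- Cauchy–Schwarz, in its linearized form. -/
theorem le_card_crossCherries (G : SimpleGraph V) (P Q : Finset V) (r : ℝ) :
    2 * r * (crossEdges G P Q).card - r ^ 2 * (discord P Q).card ≤
      (crossCherries G P Q).card := by
  classical
  set d : V → ℕ := fun z => ((P ∩ Q).filter fun b => G.Adj z b).card with hd
  have hE : (crossEdges G P Q).card = ∑ z ∈ discord P Q, d z := by
    rw [crossEdges, Finset.card_filter, Finset.sum_product]
    exact Finset.sum_congr rfl fun z _ => (Finset.card_filter _ _).symm
  have hS : (crossCherries G P Q).card = ∑ z ∈ discord P Q, d z * d z := by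
    rw [crossCherries, Finset.card_filter, Finset.sum_product]
    refine Finset.sum_congr rfl fun z _ => ?_
    rw [← Finset.card_filter, hd, ← Finset.card_product, ← Finset.filter_product]
  rw [hE, hS]
  push_cast
  rw [Finset.mul_sum, ← nsmul_eq_mul', ← Finset.sum_const, ← Finset.sum_sub_distrib]
  refine Finset.sum_le_sum fun z _ => ?_
  nlinarith [sq_nonneg ((d z : ℝ) - r)]

end Counting

/-! ### The supermartingale -/

section Potential

variable {V : Type*}

/-- The weight of a discordant vertex after `k` of `n` arrivals. -/
noncomputable def discordWeight (n k : ℕ) : ℝ :=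
  n / (n - k : ℝ) * ∑ j ∈ Finset.Ico k n, 1 / ((j : ℝ) + 1)

/-- An upper bound for the expected number of vertices that are yet to become discordant. -/
noncomputable def potential (G : SimpleGraph V) (n k : ℕ) (P Q : Finset V) : ℝ :=
  discordWeight n k * (discord P Q).card + (k / n : ℝ) * (crossEdges G P Q).card

theorem discordWeight_nonneg {n k : ℕ} (hk : k ≤ n) : 0 ≤ discordWeight n k := by
  have : (k : ℝ) ≤ n := Nat.cast_le.2 hk
  exact mul_nonneg (div_nonneg (Nat.cast_nonneg n) (by linarith))
    (Finset.sum_nonneg fun j _ => by positivity)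

theorem potential_nonneg (G : SimpleGraph V) {n k : ℕ} (hk : k ≤ n) (P Q : Finset V) :
    0 ≤ potential G n k P Q :=
  add_nonneg (mul_nonneg (discordWeight_nonneg hk) (Nat.cast_nonneg _)) (by positivity)

theorem sub_mul_discordWeight {n k : ℕ} (hk : k ≤ n) :
    (n - k : ℝ) * discordWeight n k = n * ∑ j ∈ Finset.Ico k n, 1 / ((j : ℝ) + 1) := by
  rcases hk.eq_or_lt with rfl | hlt
  · simp
  · have : (n - k : ℝ) ≠ 0 := by
      have : (k : ℝ) < n := Nat.cast_lt.2 hlt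
      linarith
    rw [discordWeight]
    field_simp

/-- On average over the next arrival, the potential pays for the newly discordant vertices. -/
theorem sum_card_newDiscord_add_potential_le (G : SimpleGraph V) {n k : ℕ} (hk : k < n)
    {P Q U : Finset V} (hP : P ⊆ U) (hQ : Q ⊆ U) (hU : U.card = n - k) :
    ∑ u ∈ U, ((newDiscord G P Q u).card +
        potential G n (k + 1) (aliveStep G P u) (aliveStep G Q u)) ≤
      (n - k : ℝ) * potential G n k P Q := by
  have h1 : ∑ u ∈ U, ((newDiscord G P Q u).card : ℝ) ≤ (crossEdges G P Q).card := by
    exact_mod_cast sum_card_newDiscord_le G hP hQ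
  have hUc : (U.card : ℝ) = n - k := by rw [hU, Nat.cast_sub hk.le]
  have h2 : ∑ u ∈ U, ((discord (aliveStep G P u) (aliveStep G Q u)).card : ℝ) +
      (discord P Q).card ≤ (n - k) * (discord P Q).card := by
    rw [← hUc]
    exact_mod_cast sum_card_discord_step_le G hP hQ
  have h3 : ∑ u ∈ U, ((crossEdges G (aliveStep G P u) (aliveStep G Q u)).card : ℝ) +
      (crossCherries G P Q).card ≤ (n - k) * (crossEdges G P Q).card := by
    rw [← hUc]
    exact_mod_cast sum_card_crossEdges_step_le G hP hQ
  have h4 := le_card_crossCherries G P Q (n / (k + 1))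
  have ha := sub_mul_discordWeight hk.le
  have ha' := sub_mul_discordWeight (Nat.succ_le_of_lt hk)
  rw [Finset.sum_eq_sum_Ico_succ_bot hk] at ha
  have hw := discordWeight_nonneg (Nat.succ_le_of_lt hk)
  simp only [potential, Finset.sum_add_distrib, ← Finset.mul_sum]
  generalize ∑ j ∈ Finset.Ico (k + 1) n, 1 / ((j : ℝ) + 1) = A at *
  generalize ∑ u ∈ U, ((newDiscord G P Q u).card : ℝ) = g at *
  generalize ∑ u ∈ U, ((discord (aliveStep G P u) (aliveStep G Q u)).card : ℝ) = z' at *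
  generalize ∑ u ∈ U, ((crossEdges G (aliveStep G P u) (aliveStep G Q u)).card : ℝ) = e' at *
  have hz : (0 : ℝ) ≤ (discord P Q).card := Nat.cast_nonneg _
  have he : (0 : ℝ) ≤ (crossEdges G P Q).card := Nat.cast_nonneg _
  generalize ((discord P Q).card : ℝ) = z at *
  generalize ((crossEdges G P Q).card : ℝ) = e at *
  generalize ((crossCherries G P Q).card : ℝ) = s at *
  generalize discordWeight n k = a at *
  generalize discordWeight n (k + 1) = a' at *
  have hn : (0 : ℝ) < n := Nat.cast_pos.2 (by omega)
  have hk0 : (0 : ℝ) ≤ k := Nat.cast_nonneg k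
  push_cast at *
  have hz' : a' * z' ≤ n * A * z := by
    rw [← ha']
    nlinarith [mul_le_mul_of_nonneg_left h2 hw]
  have he' : ((k : ℝ) + 1) / n * e' ≤
      ((k : ℝ) + 1) / n * ((n - k) * e) - 2 * e + n / (k + 1) * z := by
    have h5 : ((k : ℝ) + 1) / n * e' ≤
        ((k : ℝ) + 1) / n * ((n - k) * e - (2 * (n / (k + 1)) * e - (n / (k + 1)) ^ 2 * z)) :=
      mul_le_mul_of_nonneg_left (by linarith) (by positivity)
    refine h5.trans_eq ?_
    field_simp
    ring
  have hke : (n - k : ℝ) * (k / n * e) =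
      ((k : ℝ) + 1) / n * ((n - k) * e) - e + k / n * e := by
    field_simp
    ring
  have hke' : 0 ≤ (k : ℝ) / n * e := by positivity
  have haz : (n - k : ℝ) * (a * z) = n * A * z + n / (k + 1) * z := by
    rw [← mul_assoc, ha]
    field_simp
    ring
  rw [mul_add, haz, hke]
  linarith

end Potential

section Averaging

variable {V : Type*} {n : ℕ}

/-- The sequence of arrivals given by an enumeration of the vertices. -/
def arrivals (v : V) (e : Fin n ≃ V) (k : ℕ) : V :=
  if h : k < n then e ⟨k, h⟩ else v

theorem arrivals_of_lt (v : V) (e : Fin n ≃ V) {k : ℕ} (h : k < n) :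
    arrivals v e k = e ⟨k, h⟩ := dif_pos h

theorem arrivals_swap_trans (v : V) (e : Fin n ≃ V) {i j : Fin n} {l : ℕ} (hi : l < i)
    (hij : i ≤ j) : arrivals v ((Equiv.swap i j).trans e) l = arrivals v e l := by
  have hl : l < n := hi.trans i.2
  have hij' : (i : ℕ) ≤ j := hij
  rw [arrivals_of_lt v _ hl, arrivals_of_lt v _ hl, Equiv.trans_apply,
    Equiv.swap_apply_of_ne_of_ne]
  · exact fun h => hi.ne (congrArg Fin.val h)
  · exact fun h => (hi.trans_le hij').ne (congrArg Fin.val h)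

theorem aliveSeq_subset_map (G : SimpleGraph V) (v : V) (S : Finset V) (e : Fin n ≃ V) (k : Fin n) :
    aliveSeq G S (arrivals v e) k ⊆ (Finset.Ici k).map e.toEmbedding := by
  intro w hw
  rw [Finset.mem_map]
  refine ⟨e.symm w, Finset.mem_Ici.2 ?_, by simp⟩
  by_contra! hlt
  have h := not_mem_aliveSeq_of_lt (G := G) (S := S) (x := arrivals v e)
    (show (e.symm w : ℕ) < k from hlt)
  rw [arrivals_of_lt v e (e.symm w).2] at h
  exact h (by simpa using hw)

variable [Fintype V] [DecidableEq V]

/-- In a uniformly random enumeration, given the first `k` vertices, the next one is uniformly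
distributed among the others. -/
theorem sum_enumerations_next (v : V) (k : Fin n) (F : (Fin n ≃ V) → V → ℝ)
    (hF : ∀ e j, k ≤ j → F ((Equiv.swap k j).trans e) = F e) :
    (n - k : ℝ) * ∑ e : Fin n ≃ V, F e (arrivals v e k) =
      ∑ e : Fin n ≃ V, ∑ u ∈ (Finset.Ici k).map e.toEmbedding, F e u := by
  simp only [Finset.sum_map, Equiv.coe_toEmbedding]
  rw [Finset.sum_comm]
  have key : ∀ j ∈ Finset.Ici k,
      ∑ e : Fin n ≃ V, F e (e j) = ∑ e : Fin n ≃ V, F e (arrivals v e k) := by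
    intro j hj
    refine Fintype.sum_equiv ((Equiv.swap k j).equivCongr (Equiv.refl V)) _ _ fun e => ?_
    have h1 : (Equiv.swap k j).equivCongr (Equiv.refl V) e = (Equiv.swap k j).trans e := by
      ext i
      simp [Equiv.equivCongr]
    rw [h1, hF e j (Finset.mem_Ici.1 hj), arrivals_of_lt v _ k.2]
    simp
  rw [Finset.sum_congr rfl key, Finset.sum_const, Fin.card_Ici, nsmul_eq_mul,
    Nat.cast_sub k.2.le]

variable (G : SimpleGraph V) (v : V)

/-- The vertices of `G` that are alive after `k` arrivals. -/
noncomputable def aliveFull (e : Fin n ≃ V) (k : ℕ) : Finset V :=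
  aliveSeq G Finset.univ (arrivals v e) k

/-- The vertices of `G` without `v` that are alive after `k` arrivals. -/
noncomputable def aliveDeleted (e : Fin n ≃ V) (k : ℕ) : Finset V :=
  aliveSeq G (Finset.univ.erase v) (arrivals v e) k

/-- The number of vertices that become discordant in the `k`-th step. -/
noncomputable def gain (e : Fin n ≃ V) (k : ℕ) : ℝ :=
  (newDiscord G (aliveFull G v e k) (aliveDeleted G v e k) (arrivals v e k)).card

theorem sum_gain_add_potential_le {k : ℕ} (hk : k < n) :
    ∑ e : Fin n ≃ V, (gain G v e k +
        potential G n (k + 1) (aliveFull G v e (k + 1)) (aliveDeleted G v e (k + 1))) ≤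
      ∑ e : Fin n ≃ V, potential G n k (aliveFull G v e k) (aliveDeleted G v e k) := by
  have hnk : (0 : ℝ) < n - k := sub_pos.2 (Nat.cast_lt.2 hk)
  refine le_of_mul_le_mul_left ?_ hnk
  have h := sum_enumerations_next v ⟨k, hk⟩ (fun e u =>
    ((newDiscord G (aliveFull G v e k) (aliveDeleted G v e k) u).card +
      potential G n (k + 1) (aliveStep G (aliveFull G v e k) u)
        (aliveStep G (aliveDeleted G v e k) u))) (by
    intro e j hj
    have h0 : ∀ S, aliveSeq G S (arrivals v ((Equiv.swap ⟨k, hk⟩ j).trans e)) k =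
        aliveSeq G S (arrivals v e) k := fun S =>
      aliveSeq_congr G S fun l hl => arrivals_swap_trans v e hl hj
    simp only [aliveFull, aliveDeleted, h0])
  refine h.trans_le ?_
  rw [Finset.mul_sum]
  refine Finset.sum_le_sum fun e _ => ?_
  refine sum_card_newDiscord_add_potential_le G hk (aliveSeq_subset_map G v _ e ⟨k, hk⟩)
    (aliveSeq_subset_map G v _ e ⟨k, hk⟩) ?_
  rw [Finset.card_map, Fin.card_Ici]

theorem sum_gain_le :
    ∑ e : Fin n ≃ V, ∑ k ∈ Finset.range n, gain G v e k ≤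
      Fintype.card (Fin n ≃ V) * (1 + Real.log n) := by
  have key : ∀ k ≤ n, ∑ e : Fin n ≃ V, (∑ j ∈ Finset.range k, gain G v e j +
      potential G n k (aliveFull G v e k) (aliveDeleted G v e k)) ≤
      ∑ e : Fin n ≃ V, potential G n 0 (aliveFull G v e 0) (aliveDeleted G v e 0) := by
    intro k
    induction k with
    | zero => simp
    | succ k ih =>
      intro hk
      refine le_trans ?_ (ih (by omega))
      simp only [Finset.sum_range_succ, Finset.sum_add_distrib, add_assoc]
      have := sum_gain_add_potential_le G v (n := n) (k := k) hk
      rw [Finset.sum_add_distrib] at this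
      linarith
  have h0 : ∀ e : Fin n ≃ V,
      potential G n 0 (aliveFull G v e 0) (aliveDeleted G v e 0) ≤ 1 + Real.log n := by
    intro e
    have hn : (n : ℝ) ≠ 0 := by
      have := (e.symm v).pos
      positivity
    have h1 : discord (aliveFull G v e 0) (aliveDeleted G v e 0) = {v} := by
      ext w
      simp [mem_discord, aliveFull, aliveDeleted, aliveSeq]
    refine le_trans (le_of_eq ?_) (harmonic_le_one_add_log n)
    rw [potential, h1, discordWeight, harmonic]
    simp [hn]
  refine le_trans (Finset.sum_le_sum fun e _ => ?_) ((key n le_rfl).trans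
    ((Finset.sum_le_sum fun e _ => h0 e).trans (by simp [mul_add])))
  exact le_add_of_nonneg_right (potential_nonneg G le_rfl _ _)

end Averaging

/-! ### Affected vertices and random rankings -/

theorem sorts_of_strictMono {V : Type*} {n : ℕ} (v : V) {R : Type*} [LinearOrder R] {π : V → R} {e : Fin n ≃ V}
    (h : StrictMono (π ∘ e)) : Sorts π (arrivals v e) n where
  lt i j hij hj := by
    rw [arrivals_of_lt v e (hij.trans hj), arrivals_of_lt v e hj]
    exact h (Fin.mk_lt_mk.2 hij)
  surj w := ⟨e.symm w, (e.symm w).2, by simp [arrivals_of_lt v e (e.symm w).2]⟩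

section Affected

variable {V : Type*} [Fintype V] [DecidableEq V] {n : ℕ} (G : SimpleGraph V) (v : V)

/-- The vertices that do not die in the same step in both graphs. -/
def diedApart (e : Fin n ≃ V) : Set V :=
  {u | u = v ∨ ∃ k < n, u ∈ aliveFull G v e k ∧ u ∉ aliveFull G v e (k + 1) ∧
    ¬ (u ∈ aliveDeleted G v e k ∧ u ∉ aliveDeleted G v e (k + 1))}

theorem affected_eq_diedApart {R : Type*} [LinearOrder R] {π : V → R} {e : Fin n ≃ V}
    (h : StrictMono (π ∘ e)) : affected G {v}ᶜ (G.induce {v}ᶜ) π = diedApart G v e := by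
  have hs := sorts_of_strictMono v h
  have hfull : ∀ {u k}, k < n → u ∈ aliveFull G v e k → u ∉ aliveFull G v e (k + 1) →
      eliminator G π u = arrivals v e k := fun {u k} hk h1 h2 =>
    hs.eliminator_comap (G := G) (Function.Embedding.refl V) (by simp) hk (u := u) h1 h2
  have hdel : ∀ {u k} (hu : u ∈ ({v}ᶜ : Set V)), k < n → u ∈ aliveDeleted G v e k →
      u ∉ aliveDeleted G v e (k + 1) →
      ((eliminator (G.induce {v}ᶜ) (fun w : ({v}ᶜ : Set V) => π w) ⟨u, hu⟩ : _) : V) =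
        arrivals v e k := fun {u k} hu hk h1 h2 =>
    hs.eliminator_comap (G := G) (Function.Embedding.subtype _) (by simp) hk (u := ⟨u, hu⟩) h1 h2
  ext u
  simp only [affected, diedApart, Set.mem_ofPred_eq]
  constructor
  · intro hu
    by_contra! hcon
    obtain ⟨huv, hcon⟩ := hcon
    obtain ⟨k, hk, h1, h2⟩ := exists_dies (G := G) hs.surj (Finset.mem_univ u)
    obtain ⟨h3, h4⟩ := hcon k hk h1 h2
    exact hu ⟨huv, (hdel huv hk h3 h4).trans (hfull hk h1 h2).symm⟩
  · rintro (rfl | ⟨k, hk, h1, h2, h3⟩) ⟨huv, heq⟩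
    · exact huv rfl
    · obtain ⟨j, hj, h4, h5⟩ := exists_dies (G := G) hs.surj
        (Finset.mem_erase.2 ⟨huv, Finset.mem_univ u⟩)
      rw [hdel huv hj h4 h5, hfull hk h1 h2] at heq
      obtain rfl := hs.inj hj hk heq
      exact h3 ⟨h4, h5⟩

theorem exists_mem_newDiscord {e : Fin n ≃ V} {u : V} (huv : u ≠ v) {k : ℕ}
    (hk : u ∈ discord (aliveFull G v e k) (aliveDeleted G v e k)) :
    ∃ j < k, u ∈ newDiscord G (aliveFull G v e j) (aliveDeleted G v e j) (arrivals v e j) := by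
  induction k with
  | zero =>
    rw [mem_discord] at hk
    simp [aliveFull, aliveDeleted, aliveSeq, huv] at hk
  | succ k ih =>
    rcases mem_discord_step hk with h | h
    · obtain ⟨j, hj, h⟩ := ih h
      exact ⟨j, by omega, h⟩
    · exact ⟨k, by omega, h⟩

theorem ncard_diedApart_le (e : Fin n ≃ V) :
    ((diedApart G v e).ncard : ℝ) ≤ 1 + ∑ k ∈ Finset.range n, gain G v e k := by
  have hsub : diedApart G v e ⊆ ↑({v} ∪ (Finset.range n).biUnion fun k =>
      newDiscord G (aliveFull G v e k) (aliveDeleted G v e k) (arrivals v e k)) := by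
    intro u hu
    rw [Finset.mem_coe, Finset.mem_union, Finset.mem_singleton, Finset.mem_biUnion]
    by_cases huv : u = v
    · exact Or.inl huv
    obtain ⟨k, hk, h1, h2, h3⟩ := hu.resolve_left huv
    right
    have h4 : u ∈ discord (aliveFull G v e k) (aliveDeleted G v e k) ∨
        u ∈ discord (aliveFull G v e (k + 1)) (aliveDeleted G v e (k + 1)) := by
      rw [mem_discord, mem_discord]
      tauto
    rcases h4 with h4 | h4
    all_goals
      obtain ⟨j, hj, h5⟩ := exists_mem_newDiscord G v huv h4
      exact ⟨j, Finset.mem_range.2 (by omega), h5⟩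
  have h1 := Set.ncard_le_ncard hsub (Finset.finite_toSet _)
  rw [Set.ncard_coe_finset] at h1
  have h2 := h1.trans ((Finset.card_union_le _ _).trans
    (Nat.add_le_add_left Finset.card_biUnion_le _))
  rw [Finset.card_singleton] at h2
  simp only [gain]
  exact_mod_cast h2

theorem sum_ncard_diedApart_le :
    ∑ e : Fin n ≃ V, ((diedApart G v e).ncard : ℝ) ≤
      Fintype.card (Fin n ≃ V) * (2 + Real.log n) := by
  refine (Finset.sum_le_sum fun e _ => ncard_diedApart_le G v e).trans ?_
  have := sum_gain_le G v (n := n)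
  rw [Finset.sum_add_distrib, Finset.sum_const, nsmul_one, Finset.card_univ]
  linarith

end Affected

section RandomRanking

variable {V : Type*} {n : ℕ}

/-- The rankings that sort the vertices in the order `e`. -/
def sortedBy (e : Fin n ≃ V) : Set (V → unitInterval) :=
  {π | StrictMono (π ∘ e)}

theorem eq_of_mem_sortedBy {e e' : Fin n ≃ V} {π : V → unitInterval} (h : π ∈ sortedBy e)
    (h' : π ∈ sortedBy e') : e = e' := by
  have hr : Set.range (π ∘ e) = Set.range (π ∘ e') := by
    rw [e.surjective.range_comp, e'.surjective.range_comp]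
  have heq := (StrictMono.range_inj h h').1 hr
  have hinj : Function.Injective π := by
    have := StrictMono.injective h
    rwa [e.injective_comp] at this
  exact Equiv.ext fun i => hinj (congrFun heq i)

theorem measurableSet_sortedBy (e : Fin n ≃ V) : MeasurableSet (sortedBy e) := by
  have h : sortedBy e = ⋂ i : Fin n, ⋂ j : Fin n, ⋂ _ : i < j, {π | π (e i) < π (e j)} := by
    ext π
    simp only [sortedBy, StrictMono, Set.mem_ofPred_eq, Set.mem_iInter, Function.comp]
  rw [h]
  exact MeasurableSet.iInter fun i => MeasurableSet.iInter fun j => MeasurableSet.iInter fun _ =>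
    measurableSet_lt (measurable_pi_apply _) (measurable_pi_apply _)

variable [Fintype V]

instance : IsProbabilityMeasure (randomRanking V) :=
  inferInstanceAs (IsProbabilityMeasure (Measure.pi _))

theorem ae_injective_randomRanking : ∀ᵐ π ∂randomRanking V, Function.Injective π := by
  have key : ∀ i j : V, i ≠ j → ∀ᵐ π ∂randomRanking V, π i ≠ π j := by
    intro i j hij
    have hind := (ProbabilityTheory.iIndepFun_pi (μ := fun _ : V => (volume : Measure unitInterval))
      (X := fun _ => id) fun _ => aemeasurable_id).indepFun hij
    simp only [id] at hind
    replace hind := (ProbabilityTheory.indepFun_iff_map_prod_eq_prod_map_map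
      (measurable_pi_apply i).aemeasurable (measurable_pi_apply j).aemeasurable).1 hind
    have hi := (measurePreserving_eval (fun _ : V => (volume : Measure unitInterval)) i).map_eq
    have hj := (measurePreserving_eval (fun _ : V => (volume : Measure unitInterval)) j).map_eq
    have hdiag : MeasurableSet {p : unitInterval × unitInterval | p.1 = p.2} :=
      measurableSet_eq_fun measurable_fst measurable_snd
    have h0 : (Measure.pi fun _ : V => (volume : Measure unitInterval)).map
        (fun π => (π i, π j)) {p | p.1 = p.2} = 0 := by
      rw [hind, Measure.measure_prod_null hdiag]
      refine Filter.Eventually.of_forall fun x => ?_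
      have h1 : Prod.mk x ⁻¹' {p : unitInterval × unitInterval | p.1 = p.2} = {x} := by
        ext y
        simp [eq_comm]
      change (Measure.map (fun π : V → unitInterval => π j) _) _ = 0
      rw [h1, show (fun π : V → unitInterval => π j) = Function.eval j from rfl, hj,
        measure_singleton]
    rw [Measure.map_apply ((measurable_pi_apply i).prodMk (measurable_pi_apply j)) hdiag] at h0
    rw [ae_iff]
    simpa [randomRanking] using h0
  have h2 : ∀ᵐ π ∂randomRanking V, ∀ i j : V, i ≠ j → π i ≠ π j := by
    rw [ae_all_iff]
    intro i
    rw [ae_all_iff]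
    intro j
    by_cases hij : i = j
    · exact Filter.Eventually.of_forall fun π h => absurd hij h
    · filter_upwards [key i j hij] with π hπ _ using hπ
  filter_upwards [h2] with π hπ i j hij
  by_contra hne
  exact hπ i j hne hij

theorem measure_sortedBy_eq (e e' : Fin n ≃ V) :
    randomRanking V (sortedBy e) = randomRanking V (sortedBy e') := by
  have h := measurePreserving_piCongrLeft (α := fun _ : V => unitInterval)
    (fun _ => (volume : Measure unitInterval)) (e'.symm.trans e)
  have h2 := h.measure_preimage (measurableSet_sortedBy e).nullMeasurableSet
  refine Eq.trans h2.symm ?_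
  change randomRanking V _ = _
  congr 1
  ext π
  have h3 : (MeasurableEquiv.piCongrLeft (fun _ : V => unitInterval) (e'.symm.trans e) π) ∘ e =
      π ∘ e' := by
    funext i
    have := Equiv.piCongrLeft_apply_apply (P := fun _ : V => unitInterval)
      (e := e'.symm.trans e) π (e' i)
    simpa [MeasurableEquiv.coe_piCongrLeft] using this
  change StrictMono (_ ∘ e) ↔ StrictMono (π ∘ e')
  rw [h3]

theorem exists_mem_sortedBy (hn : Fintype.card V = n) {π : V → unitInterval}
    (hπ : Function.Injective π) : ∃ e : Fin n ≃ V, π ∈ sortedBy e := by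
  classical
  let _ : LinearOrder V := LinearOrder.lift' π hπ
  refine ⟨(Fintype.orderIsoFinOfCardEq V hn).toEquiv, fun i j hij => ?_⟩
  exact (Fintype.orderIsoFinOfCardEq V hn).lt_iff_lt.2 hij

/-- A quantity that depends only on the order of the ranks is integrable, and its expectation is
at most its average over all orders. -/
theorem integral_le_of_sortedBy [DecidableEq V] (hn : Fintype.card V = n)
    {f : (V → unitInterval) → ℝ} {c : (Fin n ≃ V) → ℝ} {B : ℝ} (hB : 0 ≤ B)
    (hf : ∀ e, ∀ π ∈ sortedBy e, f π = c e)
    (hc : ∑ e, c e ≤ Fintype.card (Fin n ≃ V) * B) :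
    Integrable f (randomRanking V) ∧ ∫ π, f π ∂randomRanking V ≤ B := by
  have hae : f =ᵐ[randomRanking V] fun π => ∑ e, (sortedBy e).indicator (fun _ => c e) π := by
    filter_upwards [ae_injective_randomRanking] with π hπ
    obtain ⟨e, he⟩ := exists_mem_sortedBy hn hπ
    rw [Finset.sum_eq_single e, Set.indicator_of_mem he, hf e π he]
    · exact fun e' _ hne => Set.indicator_of_notMem (fun h => hne (eq_of_mem_sortedBy h he)) _
    · exact fun h => absurd (Finset.mem_univ e) h
  have hint : ∀ e : Fin n ≃ V,
      Integrable ((sortedBy e).indicator fun _ => c e) (randomRanking V) := fun e =>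
    (integrable_const (c e)).indicator (measurableSet_sortedBy e)
  refine ⟨(integrable_congr hae).2 (integrable_finsetSum _ fun e _ => hint e), ?_⟩
  rw [integral_congr_ae hae, integral_finsetSum _ fun e _ => hint e]
  simp only [integral_indicator_const _ (measurableSet_sortedBy _), smul_eq_mul]
  obtain ⟨e₀⟩ : Nonempty (Fin n ≃ V) := ⟨(Fintype.equivFinOfCardEq hn).symm⟩
  have hp : ∀ e : Fin n ≃ V,
      (randomRanking V).real (sortedBy e) = (randomRanking V).real (sortedBy e₀) := fun e => by
    rw [measureReal_def, measureReal_def, measure_sortedBy_eq e e₀]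
  simp only [hp]
  rw [← Finset.mul_sum]
  have htot : (Fintype.card (Fin n ≃ V) : ℝ) * (randomRanking V).real (sortedBy e₀) ≤ 1 := by
    have h1 : ∑ e : Fin n ≃ V, (randomRanking V).real (sortedBy e) ≤ 1 := by
      rw [← measureReal_biUnion_finset
        (fun e _ e' _ hne => Set.disjoint_left.2 fun π h h' => hne (eq_of_mem_sortedBy h h'))
        (fun e _ => measurableSet_sortedBy e)]
      exact measureReal_le_one
    simp only [hp] at h1
    simpa using h1
  calc _ ≤ (randomRanking V).real (sortedBy e₀) * (Fintype.card (Fin n ≃ V) * B) :=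
        mul_le_mul_of_nonneg_left hc measureReal_nonneg
    _ = (Fintype.card (Fin n ≃ V) * (randomRanking V).real (sortedBy e₀)) * B := by ring
    _ ≤ 1 * B := mul_le_mul_of_nonneg_right htot hB
    _ = B := one_mul B

end RandomRanking

end RandomLFMIS

theorem mainTheorem2 :
    ∃ C : ℝ, 0 < C ∧
      ∀ (V : Type*) [Fintype V] (G : SimpleGraph V) (v : V), 2 ≤ Fintype.card V →
        Integrable
            (fun π : V → unitInterval =>
              ((RandomLFMIS.affected G {v}ᶜ (G.induce {v}ᶜ) π).ncard : ℝ))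
            (RandomLFMIS.randomRanking V) ∧
          ∫ π : V → unitInterval,
              ((RandomLFMIS.affected G {v}ᶜ (G.induce {v}ᶜ) π).ncard : ℝ)
                ∂(RandomLFMIS.randomRanking V) ≤
            C * Real.log (Fintype.card V) := by
  classical
  refine ⟨4, by norm_num, fun V _ G v hV => ?_⟩
  have hlog : Real.log 2 ≤ Real.log (Fintype.card V) :=
    Real.log_le_log (by norm_num) (by exact_mod_cast hV)
  have h2 := Real.log_two_gt_d9
  obtain ⟨h3, h4⟩ := RandomLFMIS.integral_le_of_sortedBy (V := V) rfl
    (f := fun π => ((RandomLFMIS.affected G {v}ᶜ (G.induce {v}ᶜ) π).ncard : ℝ))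
    (c := fun e => ((RandomLFMIS.diedApart G v e).ncard : ℝ))
    (B := 2 + Real.log (Fintype.card V)) (by linarith)
    (fun e π h => by rw [RandomLFMIS.affected_eq_diedApart G v h])
    (RandomLFMIS.sum_ncard_diedApart_le G v)
  exact ⟨h3, h4.trans (by linarith)⟩
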